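/- Theorem 1.1. Let $r,n\geq 1$ be integers, let $q\in\mathbb{C}$ satisfy $q^m\neq 1$ for every integer $m$ with $0<m<n$, and let $t$ and $u_1,\ldots,u_{r+2}$ be formal variables. A multi-index is a tuple $\mathbf{k}=(k_1,\ldots,k_l)$ of positive integers; its weight is $k_1+\cdots+k_l$, its depth is $\mathrm{dep}(\mathbf{k})=l$, and its $i$-height is $\#\{j\mid k_j\geq i+1\}$. Put $$\overline{z}_n(\mathbf{k};q)=\sum_{n>m_1>\cdots>m_l>0}\ \prod_{i=1}^{l}\frac{q^{(k_i-1)m_i}}{(1-q^{m_i})^{k_i}},\qquad \overline{z}_n^t(\mathbf{k};q)=\sum_{\mathbf{p}}\overline{z}_n(\mathbf{p};q)\,t^{\,l-\mathrm{dep}(\mathbf{p})}\in\mathbb{C}[t],$$ where $\mathbf{p}$ runs over all $(k_1\square k_2\square\cdots\square k_l)$ in which each of the $l-1$ boxes is filled by "$,$", "$+$" or "$-1+$" (one term for each filling, so a multi-index that arises from several fillings is counted with multiplicity). For nonnegative integers $k,l,h_1,\ldots,h_r$ let $G_n^t(k,l,h_1,\ldots,h_r;q)$ be the sum of $\overline{z}_n^t(\mathbf{k};q)$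 over all multi-indices $\mathbf{k}$ of weight $k$, depth $l$ and $i$-height $h_i$ for $i=1,\ldots,r$ (zero if there is none), except that $G_n^t(0,0,\ldots,0;q)=1$. Let $$\Psi_n^t(q)=\sum_{k,l,h_1,\ldots,h_r\geq 0}G_n^t(k,l,h_1,\ldots,h_r;q)\,u_1^{k-l-\sum_{j=1}^r h_j}u_2^{l-h_1}u_3^{h_1-h_2}\cdots u_{r+1}^{h_{r-1}-h_r}u_{r+2}^{h_r}\in\mathbb{C}[t][[u_1,\ldots,u_{r+2}]].$$ In the field of fractions of $\mathbb{C}[t][[u_1,\ldots,u_{r+2}]]$ let $$x_1=\frac{u_1}{1+u_1},\qquad x_i=\sum_{j=i}^{r+1}(-1)^{j-i}\binom{j-2}{i-2}\left(u_j-\frac{u_{r+2}}{u_1^{r+2-j}}\right)+\frac{u_{r+2}}{u_1^{r+2-i}(1+u_1)^{i-1}}\quad(i=2,\ldots,r+2),$$ and, for $s\in\{t,t-1\}$, $$P^s(T)=T^{r+1}-(x_1+s x_2)T^r-s\sum_{i=0}^{r-1}(x_{r+2-i}-x_1x_{r+1-i})T^i.$$ Then $\prod_{j=1}^{n-1}P^t(1-q^j)\neq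 0$ and $$\Psi_n^t(q)=\frac{\prod_{j=1}^{n-1}P^{t-1}(1-q^j)}{\prod_{j=1}^{n-1}P^{t}(1-q^j)}.$$ -/

import Mathlib

noncomputable section

namespace QHarmonic

open Polynomial

/-- For a multi-index `k = (k_1, …, k_l)` the sum
`∑_{n > m_1 > ⋯ > m_l > 0} ∏ i, q^((k_i - 1) m_i) / (1 - q^(m_i))^(k_i)`.
Multi-indices are lists of positive integers. -/
def zbar (n : ℕ) (q : ℂ) (k : List ℕ) : ℂ :=
  ∑ m ∈ (Fintype.piFinset fun _ : Fin k.length => Finset.Ioo 0 n) with StrictAnti m,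
    ∏ i, q ^ ((k.get i - 1) * m i) / (1 - q ^ m i) ^ k.get i

/-- All multi-indices `(a □ k_1 □ ⋯ □ k_l)`, one for each way to fill every box by
a comma, by `+` or by `-1+` (so the list has `3 ^ l` entries, with repetitions). -/
def fillingsFrom : ℕ → List ℕ → List (List ℕ)
  | a, [] => [[a]]
  | a, b :: k =>
      (fillingsFrom b k).map (fun p => a :: p) ++ fillingsFrom (a + b) k
        ++ fillingsFrom (a - 1 + b) k

/-- All multi-indices `(k_1 □ ⋯ □ k_l)`, one for each filling of the `l - 1` boxes. -/
def fillings : List ℕ → List (List ℕ)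
  | [] => [[]]
  | a :: k => fillingsFrom a k

/-- The modified interpolated finite multiple harmonic `q`-series
`∑_p zbar_n(p; q) t^(l - dep p)`, a polynomial in the formal parameter `t`. -/
def zbarInterp (n : ℕ) (q : ℂ) (k : List ℕ) : ℂ[X] :=
  ((fillings k).map fun p => C (zbar n q p) * X ^ (k.length - p.length)).sum

/-- The `i`-height of a multi-index: the number of entries that are at least `i + 1`. -/
def height (i : ℕ) (k : List ℕ) : ℕ := k.countP fun a => i + 1 ≤ a

/-- The set `I(k, l, h_1, …, h_r)` of multi-indices of weight `k`, depth `l` and `i`-height `h_i`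
for `1 ≤ i ≤ r`; the value `h i` of `h : Fin r → ℕ` is the number `h_{i+1}`. A multi-index of
weight `k` is a composition of `k`. -/
def indexSet {r : ℕ} (k l : ℕ) (h : Fin r → ℕ) : Finset (Composition k) :=
  {c | c.length = l ∧ ∀ i : Fin r, height (i + 1) c.blocks = h i}

/-- The sum `G_n^t(k, l, h_1, …, h_r; q)`. The convention that it is `1` for
`k = l = h_1 = ⋯ = h_r = 0` comes from the empty multi-index, see `G_zero`. -/
def G (n : ℕ) (q : ℂ) {r : ℕ} (k l : ℕ) (h : Fin r → ℕ) : ℂ[X] :=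
  ∑ c ∈ indexSet k l h, zbarInterp n q c.blocks

theorem G_zero (n : ℕ) (q : ℂ) (r : ℕ) : G n q 0 0 (fun _ : Fin r => 0) = 1 := by
  have hb : ∀ c : Composition 0, c.blocks = [] := fun c => by
    have := c.blocks_length
    have h2 := c.length_le
    exact List.eq_nil_of_length_eq_zero (by omega)
  have : indexSet 0 0 (fun _ : Fin r => 0) = Finset.univ := by
    ext c
    simp [indexSet, height, hb, ← Composition.blocks_length]
  rw [G, this]
  simp [hb, zbarInterp, fillings, zbar, StrictAnti, composition_card]

/-- The sequence `l, h_1, …, h_r, 0, 0, …`. -/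
def heightSeq {r : ℕ} (l : ℕ) (h : Fin r → ℕ) : ℕ → ℕ
  | 0 => l
  | i + 1 => if hi : i < r then h ⟨i, hi⟩ else 0

/-- The exponents of the monomial
`u_1^(k - l - ∑ h_j) u_2^(l - h_1) u_3^(h_1 - h_2) ⋯ u_(r+1)^(h_(r-1) - h_r) u_(r+2)^(h_r)`;
the variable `u_i` has index `i - 1` in `Fin (r + 2)`. The subtractions are never truncated
when `I(k, l, h_1, …, h_r)` is non-empty. -/
def exponent {r : ℕ} (k l : ℕ) (h : Fin r → ℕ) : Fin (r + 2) →₀ ℕ :=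
  Finsupp.equivFunOnFinite.symm <| Fin.cons (k - l - ∑ j, h j)
    fun i : Fin (r + 1) => heightSeq l h i - heightSeq l h (i + 1)

/-- The generating function `Ψ_n^t(u_1, …, u_(r+2); q)`, a formal power series in the `u_i` with
coefficients in `ℂ[t]`: the sum over all `k, l, h_1, …, h_r ≥ 0` of
`G_n^t(k, l, h_1, …, h_r; q)` times the above monomial. The sum is taken coefficient by
coefficient, where it has at most one non-zero term, see `Psi_support_subsingleton`. -/
def Psi (n : ℕ) (q : ℂ) (r : ℕ) : MvPowerSeries (Fin (r + 2)) ℂ[X] := fun e =>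
  ∑ᶠ p : ℕ × ℕ × (Fin r → ℕ),
    MvPowerSeries.coeff e
      (MvPowerSeries.monomial (exponent p.1 p.2.1 p.2.2) (G n q p.1 p.2.1 p.2.2))

theorem height_anti {i j : ℕ} (hij : i ≤ j) (k : List ℕ) : height j k ≤ height i k := by
  apply List.countP_mono_left
  intro x _ hx
  simp only [decide_eq_true_eq] at hx ⊢
  omega

theorem sum_height_le (r : ℕ) (k : List ℕ) (hk : ∀ a ∈ k, 0 < a) :
    k.length + ∑ i ∈ Finset.range r, height (i + 1) k ≤ k.sum := by
  induction k with
  | nil => simp [height]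
  | cons a k ih =>
    have ih' := ih fun b hb => hk b (List.mem_cons_of_mem _ hb)
    have ha : 0 < a := hk a (by simp)
    have key : ∀ s : ℕ, ∑ i ∈ Finset.range s, (if i + 1 + 1 ≤ a then 1 else 0) ≤ a - 1 := by
      intro s
      rw [← Finset.card_filter]
      calc _ ≤ (Finset.range (a - 1)).card := by
            apply Finset.card_le_card
            intro i hi
            simp only [Finset.mem_filter, Finset.mem_range] at hi ⊢
            omega
        _ = a - 1 := by simp
    have e : ∀ i, height (i + 1) (a :: k) = height (i + 1) k + if i + 1 + 1 ≤ a then 1 else 0 := by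
      intro i
      simp [height, List.countP_cons]
    simp only [e, Finset.sum_add_distrib, List.length_cons, List.sum_cons]
    have := key r
    omega

theorem bounds_of_G_ne_zero {n : ℕ} {q : ℂ} {r k l : ℕ} {h : Fin r → ℕ} (hG : G n q k l h ≠ 0) :
    Antitone (heightSeq l h) ∧ l + ∑ j, h j ≤ k := by
  obtain ⟨c, hc, -⟩ := Finset.exists_ne_zero_of_sum_ne_zero hG
  simp only [indexSet, Finset.mem_filter, Finset.mem_univ, true_and] at hc
  obtain ⟨rfl, hh⟩ := hc
  constructor
  · apply antitone_nat_of_succ_le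
    rintro (_ | i)
    · simp only [heightSeq]
      split_ifs with h0
      · rw [← hh, ← Composition.blocks_length]
        exact List.countP_le_length
      · simp
    · simp only [heightSeq]
      split_ifs with h1 h2
      · rw [← hh, ← hh]
        exact height_anti (by simp) _
      · omega
      · simp
      · simp
  · have := sum_height_le r c.blocks fun a ha => c.blocks_pos ha
    rw [c.blocks_sum, c.blocks_length, ← Fin.sum_univ_eq_sum_range fun i => height (i + 1) c.blocks]
      at this
    simpa only [hh] using this

theorem Psi_support_subsingleton (n : ℕ) (q : ℂ) (r : ℕ) (e : Fin (r + 2) →₀ ℕ) :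
    (Function.support fun p : ℕ × ℕ × (Fin r → ℕ) =>
      MvPowerSeries.coeff e (MvPowerSeries.monomial (exponent p.1 p.2.1 p.2.2)
        (G n q p.1 p.2.1 p.2.2))).Subsingleton := by
  classical
  rintro ⟨k, l, h⟩ hp ⟨k', l', h'⟩ hp'
  simp only [Function.mem_support, MvPowerSeries.coeff_monomial, ne_eq, ite_eq_right_iff,
    Classical.not_imp] at hp hp'
  obtain ⟨he, hG⟩ := hp
  obtain ⟨he', hG'⟩ := hp'
  obtain ⟨ha, hk⟩ := bounds_of_G_ne_zero hG
  obtain ⟨ha', hk'⟩ := bounds_of_G_ne_zero hG'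
  have hee : ∀ i, exponent k l h i = exponent k' l' h' i := fun i => by rw [← he, ← he']
  have hz : ∀ d i, r + 1 ≤ i + d → heightSeq l h i = heightSeq l' h' i := by
    intro d
    induction d with
    | zero =>
      intro i hi
      obtain ⟨j, rfl⟩ : ∃ j, i = j + 1 := ⟨i - 1, by omega⟩
      have : ¬ j < r := by omega
      simp [heightSeq, this]
    | succ d ih =>
      intro i hi
      by_cases hir : r + 1 ≤ i + d
      · exact ih i hir
      have h1 := ih (i + 1) (by omega)
      have h2 := hee (Fin.succ ⟨i, by omega⟩)
      have h3 := ha (Nat.le_succ i)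
      have h4 := ha' (Nat.le_succ i)
      simp only [exponent, Finsupp.equivFunOnFinite_symm_apply_apply, Fin.cons_succ] at h2
      simp only [Nat.succ_eq_add_one] at h3 h4
      omega
  have hl : l = l' := hz (r + 1) 0 (by omega)
  have hh : h = h' := by
    funext i
    have := hz (r + 1) (i + 1) (by omega)
    simpa [heightSeq] using this
  subst hl hh
  have h0 := hee 0
  simp only [exponent, Finsupp.equivFunOnFinite_symm_apply_apply, Fin.cons_zero] at h0
  have : k = k' := by omega
  rw [this]

/-- The fraction field of the ring `ℂ[t][[u_1, …, u_(r+2)]]`. -/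
abbrev Frac (r : ℕ) : Type := FractionRing (MvPowerSeries (Fin (r + 2)) ℂ[X])

/-- The variable `u_i`, for `1 ≤ i ≤ r + 2`. -/
def u (r i : ℕ) : Frac r :=
  algebraMap (MvPowerSeries (Fin (r + 2)) ℂ[X]) (Frac r)
    (MvPowerSeries.X (Fin.ofNat (r + 2) (i - 1)))

/-- Elements of `ℂ[t]`, in particular complex numbers and `t`, as constant series. -/
def const (r : ℕ) (a : ℂ[X]) : Frac r :=
  algebraMap (MvPowerSeries (Fin (r + 2)) ℂ[X]) (Frac r) (MvPowerSeries.C a)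

/-- The elements `x_1, …, x_(r+2)`. -/
def x (r i : ℕ) : Frac r :=
  if i = 1 then u r 1 / (1 + u r 1)
  else
    ∑ j ∈ Finset.Icc i (r + 1),
        (-1) ^ (j - i) * ((j - 2).choose (i - 2) : Frac r)
          * (u r j - u r (r + 2) / u r 1 ^ (r + 2 - j))
      + u r (r + 2) / (u r 1 ^ (r + 2 - i) * (1 + u r 1) ^ (i - 1))

/-- The value `P^s(T)`, where
`P^s(T) = T^(r+1) - (x_1 + s x_2) T^r - s ∑_{i=0}^{r-1} (x_(r+2-i) - x_1 x_(r+1-i)) T^i`. -/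
def P (r : ℕ) (s T : Frac r) : Frac r :=
  T ^ (r + 1) - (x r 1 + s * x r 2) * T ^ r
    - s * ∑ i ∈ Finset.range r, (x r (r + 2 - i) - x r 1 * x r (r + 1 - i)) * T ^ i

end QHarmonic

end

noncomputable section

namespace QHarmonic

open Polynomial

/-! Write f_m(k) = q^((k-1)m) / (1 - q^m)^k. These factors satisfy f_m(a+b) + f_m(a-1+b) = f_m(a)
f_m(b) (`factor_mul_factor`), so the fillings "+" and "-1+" together account for two neighbouring
entries sharing the same summation index. Raising n to n+1 admits the new top index n, and this
identity yields a recursion which splits off the first entry of the multi-index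
(`zbarInterp_succ_cons`).

The monomial attached to a multi-index is the product of monomials attached to its entries. With F_n
the generating series of f_n over single entries, the recursion becomes Ψ_(n+1) - Ψ_n = F_n ((1-t)
Ψ_n + t Ψ_(n+1)), that is, Ψ_(n+1) (1 - t F_n) = Ψ_n (1 - (t-1) F_n), with Ψ_1 = 1 (`Psi_succ`,
`Psi_one`).

It remains to sum F_n. Entries beyond r form a geometric series in u_1, and with T = 1 - q^n one
gets P^s(T) = T^r (T - x_1) (1 - s F_n) (`P_eq`). The prefactor does not depend on s and cancels in
the quotient; nothing vanishes, because constant coefficients do not. -/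

/-! ### Recursion in n for the interpolated sums -/

/-- The factor `q^((k - 1) m) / (1 - q^m)^k` of a multiple harmonic `q`-sum. -/
def factor (q : ℂ) (m k : ℕ) : ℂ := q ^ ((k - 1) * m) / (1 - q ^ m) ^ k

theorem factor_mul_factor {q : ℂ} {m a b : ℕ} (hm : q ^ m ≠ 1) (ha : 0 < a) (hb : 0 < b) :
    factor q m (a + b) + factor q m (a - 1 + b) = factor q m a * factor q m b := by
  obtain ⟨a, rfl⟩ := Nat.exists_eq_succ_of_ne_zero ha.ne'
  obtain ⟨b, rfl⟩ := Nat.exists_eq_succ_of_ne_zero hb.ne'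
  have h : 1 - q ^ m ≠ 0 := sub_ne_zero.mpr hm.symm
  simp only [factor, Nat.succ_eq_add_one, Nat.add_sub_cancel,
    show a + 1 + (b + 1) - 1 = a + b + 1 by omega, show a + (b + 1) - 1 = a + b by omega]
  simp only [mul_comm _ m, pow_mul]
  field_simp
  ring

theorem zbar_nil (n : ℕ) (q : ℂ) : zbar n q [] = 1 := by
  simp [zbar, StrictAnti]

theorem zbar_one_cons (q : ℂ) (a : ℕ) (k : List ℕ) : zbar 1 q (a :: k) = 0 := by
  unfold zbar
  apply Finset.sum_eq_zero
  intro m hm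
  have := Fintype.mem_piFinset.mp (Finset.mem_filter.mp hm).1 ⟨0, by simp⟩
  simp at this
  omega

/-- Split according to whether the largest summation index is below n or equal to n; in the second
case, removing it leaves a strictly decreasing tuple below n. -/
theorem zbar_succ_cons {n : ℕ} (hn : 1 ≤ n) (q : ℂ) (a : ℕ) (k : List ℕ) :
    zbar (n + 1) q (a :: k) = zbar n q (a :: k) + factor q n a * zbar n q k := by
  unfold zbar
  rw [← Finset.sum_filter_add_sum_filter_not _
    (fun m : Fin (a :: k).length → ℕ => m ⟨0, by simp⟩ < n)]
  congr 1
  · apply Finset.sum_congr _ fun _ _ => rfl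
    ext m
    simp only [Finset.mem_filter, Fintype.mem_piFinset, Finset.mem_Ioo]
    constructor
    · rintro ⟨⟨h1, h2⟩, h3⟩
      exact ⟨fun i => ⟨(h1 i).1, (h2.antitone (Fin.mk_le_of_le_val (Nat.zero_le _))).trans_lt h3⟩,
        h2⟩
    · rintro ⟨h1, h2⟩
      exact ⟨⟨fun i => ⟨(h1 i).1, (h1 i).2.trans (Nat.lt_succ_self n)⟩, h2⟩, (h1 _).2⟩
  · rw [Finset.mul_sum]
    refine Finset.sum_nbij' (fun m i => m i.succ)
      (fun m => (Fin.cons n m : Fin (k.length + 1) → ℕ)) ?_ ?_ ?_ ?_ ?_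
    · intro m hm
      simp only [Finset.mem_filter, Fintype.mem_piFinset, Finset.mem_Ioo, not_lt] at hm ⊢
      obtain ⟨⟨h1, h2⟩, h3⟩ := hm
      refine ⟨fun i => ⟨(h1 _).1, ?_⟩, fun i j hij => h2 (Fin.succ_lt_succ_iff.mpr hij)⟩
      have : m i.succ < m ⟨0, by simp⟩ := h2 (Fin.succ_pos i)
      have := (h1 ⟨0, by simp⟩).2
      omega
    · intro m hm
      simp only [Finset.mem_filter, Fintype.mem_piFinset, Finset.mem_Ioo, not_lt] at hm ⊢
      obtain ⟨h1, h2⟩ := hm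
      refine ⟨⟨fun i => ?_, ?_⟩, le_refl n⟩
      · refine Fin.cases ?_ (fun j => ?_) i
        · exact ⟨hn, Nat.lt_succ_self n⟩
        · exact ⟨(h1 j).1, (h1 j).2.trans (Nat.lt_succ_self n)⟩
      · exact Fin.strictAnti_iff_succ_lt.mpr fun i => by
          refine (?_ : ∀ i : Fin k.length, (Fin.cons n m : Fin (k.length + 1) → ℕ) i.succ <
            (Fin.cons n m : Fin (k.length + 1) → ℕ) i.castSucc) i
          intro i
          rw [Fin.cons_succ]
          obtain ⟨i, hi⟩ := i
          cases i with
          | zero => exact (h1 _).2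
          | succ i => exact h2 (show (⟨i, by omega⟩ : Fin k.length) < ⟨i + 1, hi⟩ by simp)
    · intro m hm
      simp only [Finset.mem_filter, Fintype.mem_piFinset, Finset.mem_Ioo, not_lt] at hm
      obtain ⟨⟨h1, h2⟩, h3⟩ := hm
      have h0 : m ⟨0, by simp⟩ = n := by
        have := (h1 ⟨0, by simp⟩).2
        omega
      funext i
      refine Fin.cases ?_ (fun j => ?_) i
      · exact h0.symm
      · rfl
    · intro m _
      rfl
    · intro m hm
      simp only [Finset.mem_filter, Fintype.mem_piFinset, Finset.mem_Ioo, not_lt] at hm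
      obtain ⟨⟨h1, h2⟩, h3⟩ := hm
      have h0 : m ⟨0, by simp⟩ = n := by
        have := (h1 ⟨0, by simp⟩).2
        omega
      refine (Fin.prod_univ_succ _).trans ?_
      congr 1
      rw [factor, ← h0]
      rfl

/-- The sum over all fillings of `(a □ k_1 □ ⋯ □ k_l)` of `g`, weighted by `t` to the number of
boxes not filled by a comma. -/
def fillingSum (g : List ℕ → ℂ) (a : ℕ) (k : List ℕ) : ℂ[X] :=
  ((fillingsFrom a k).map fun p => C (g p) * X ^ (k.length + 1 - p.length)).sum

/-- Ensures that the subtraction in the exponent of t is never truncated, so each merged box costs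
exactly one factor t. -/
theorem length_le_of_mem_fillingsFrom {a : ℕ} {k p : List ℕ} (hp : p ∈ fillingsFrom a k) :
    p.length ≤ k.length + 1 := by
  induction k generalizing a p with
  | nil =>
    simp only [fillingsFrom, List.mem_singleton] at hp
    simp [hp]
  | cons b k ih =>
    simp only [fillingsFrom, List.mem_append, List.mem_map] at hp
    rw [List.length_cons]
    rcases hp with (⟨p, hp, rfl⟩ | hp) | hp
    · simpa using ih hp
    · have := ih hp
      omega
    · have := ih hp
      omega

theorem fillingSum_nil (g : List ℕ → ℂ) (a : ℕ) : fillingSum g a [] = C (g [a]) := by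
  simp [fillingSum, fillingsFrom]

theorem sum_fillingsFrom_succ (g : List ℕ → ℂ) (a : ℕ) (k : List ℕ) :
    ((fillingsFrom a k).map fun p => C (g p) * X ^ (k.length + 1 + 1 - p.length)).sum =
      X * fillingSum g a k := by
  rw [fillingSum, ← List.sum_map_mul_left]
  congr 1
  apply List.map_congr_left
  intro p hp
  have := length_le_of_mem_fillingsFrom hp
  rw [show k.length + 1 + 1 - p.length = k.length + 1 - p.length + 1 by omega]
  ring

theorem fillingSum_cons (g : List ℕ → ℂ) (a b : ℕ) (k : List ℕ) :
    fillingSum g a (b :: k) = fillingSum (fun p => g (a :: p)) b k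
      + X * fillingSum g (a + b) k + X * fillingSum g (a - 1 + b) k := by
  rw [← sum_fillingsFrom_succ, ← sum_fillingsFrom_succ]
  simp [fillingSum, fillingsFrom, List.map_map, Function.comp_def, add_assoc]

theorem zbarInterp_nil (n : ℕ) (q : ℂ) : zbarInterp n q [] = 1 := by
  simp [zbarInterp, fillings, zbar_nil]

theorem zbarInterp_cons (n : ℕ) (q : ℂ) (a : ℕ) (k : List ℕ) :
    zbarInterp n q (a :: k) = fillingSum (zbar n q) a k := rfl

theorem fillingSum_add (g g' : List ℕ → ℂ) (a : ℕ) (k : List ℕ) :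
    fillingSum (fun p => g p + g' p) a k = fillingSum g a k + fillingSum g' a k := by
  simp [fillingSum, add_mul, List.sum_map_add]

theorem fillingSum_mul_left (c : ℂ) (g : List ℕ → ℂ) (a : ℕ) (k : List ℕ) :
    fillingSum (fun p => c * g p) a k = C c * fillingSum g a k := by
  simp [fillingSum, mul_assoc, List.sum_map_mul_left]

theorem fillingSum_eq_zero {g : List ℕ → ℂ} (hg : ∀ a k, g (a :: k) = 0) (a : ℕ) (k : List ℕ) :
    fillingSum g a k = 0 := by
  induction k generalizing g a with
  | nil => simp [fillingSum_nil, hg]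
  | cons b k ih =>
    rw [fillingSum_cons, ih (g := fun p => g (a :: p)) fun _ _ => hg _ _, ih hg, ih hg]
    simp

theorem zbarInterp_one_cons (q : ℂ) (a : ℕ) (k : List ℕ) : zbarInterp 1 q (a :: k) = 0 :=
  fillingSum_eq_zero (zbar_one_cons q) a k

/-- Induction on the tail, with the head a arbitrary because a merged box changes it. The two merged
terms carry t (f(a+b) + f(a-1+b)) = t f(a) f(b), and f(b) times the remaining bracket is, by the
case of head b, the increment of the sum for (b, k). The comma term supplies the missing f(a) times
the old sum for (b, k). -/
theorem zbarInterp_succ_cons {n : ℕ} (hn : 1 ≤ n) {q : ℂ} (hq : q ^ n ≠ 1) {a : ℕ} (ha : 0 < a)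
    {k : List ℕ} (hk : ∀ b ∈ k, 0 < b) :
    zbarInterp (n + 1) q (a :: k) = zbarInterp n q (a :: k) + C (factor q n a) *
      ((1 - X) * zbarInterp n q k + X * zbarInterp (n + 1) q k) := by
  induction k generalizing a with
  | nil =>
    simp only [zbarInterp_cons, fillingSum_nil, zbarInterp_nil, zbar_succ_cons hn, zbar_nil]
    simp
  | cons b k ih =>
    have hb : 0 < b := hk b (by simp)
    have ih' := fun {a : ℕ} (ha : 0 < a) => ih ha fun c hc => hk c (List.mem_cons_of_mem _ hc)
    have h1 := ih' (a := a + b) (by omega)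
    have h2 := ih' (a := a - 1 + b) (by omega)
    have h3 := ih' hb
    have hf := congrArg C (factor_mul_factor hq ha hb)
    rw [C_add, C_mul] at hf
    simp only [zbarInterp_cons] at h1 h2 h3 ⊢
    rw [fillingSum_cons, fillingSum_cons, h1, h2,
      show (fun p => zbar (n + 1) q (a :: p)) =
        fun p => zbar n q (a :: p) + factor q n a * zbar n q p from
        funext fun p => zbar_succ_cons hn q a p,
      fillingSum_add, fillingSum_mul_left, h3]
    linear_combination X * ((1 - X) * zbarInterp n q k + X * zbarInterp (n + 1) q k) * hf

/-! ### Multiplicativity of the monomials -/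

/-- The exponents of the monomial that an entry `a` of a multi-index contributes to `Psi`. -/
def entryExponent (r a : ℕ) : Fin (r + 2) →₀ ℕ :=
  Finsupp.single 0 (a - (r + 1)) + Finsupp.single (Fin.ofNat (r + 2) (min a (r + 1))) 1

/-- The exponents of the monomial that a multi-index contributes to `Psi`. -/
def listExponent (r : ℕ) (k : List ℕ) : Fin (r + 2) →₀ ℕ := (k.map (entryExponent r)).sum

/-- The weight of the multi-indices that contribute to the coefficient with exponents `e`. -/
def weightOf (r : ℕ) : (Fin (r + 2) →₀ ℕ) →+ ℕ :=
  Finsupp.weight fun i : Fin (r + 2) => max 1 (i : ℕ)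

theorem weightOf_single (r : ℕ) (i : Fin (r + 2)) (m : ℕ) :
    weightOf r (Finsupp.single i m) = m * max 1 (i : ℕ) := by
  simp [weightOf, Finsupp.weight_single]

theorem val_ofNat_min (r a : ℕ) : (Fin.ofNat (r + 2) (min a (r + 1)) : ℕ) = min a (r + 1) :=
  Nat.mod_eq_of_lt (by omega)

theorem weightOf_entryExponent {r a : ℕ} (ha : 0 < a) : weightOf r (entryExponent r a) = a := by
  rw [entryExponent, map_add, weightOf_single, weightOf_single, val_ofNat_min]
  simp
  omega

theorem weightOf_listExponent {r : ℕ} {k : List ℕ} (hk : ∀ a ∈ k, 0 < a) :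
    weightOf r (listExponent r k) = k.sum := by
  induction k with
  | nil => simp [listExponent]
  | cons a k ih =>
    have ih' := ih fun b hb => hk b (List.mem_cons_of_mem _ hb)
    rw [listExponent] at ih' ⊢
    rw [List.map_cons, List.sum_cons, map_add, ih', weightOf_entryExponent (hk a (by simp)),
      List.sum_cons]

theorem entryExponent_zero {r a : ℕ} (ha : 0 < a) : entryExponent r a 0 = a - (r + 1) := by
  have h : Fin.ofNat (r + 2) (min a (r + 1)) ≠ 0 := fun h => by
    have := congrArg Fin.val h
    rw [val_ofNat_min, Fin.val_zero] at this
    omega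
  rw [entryExponent, Finsupp.add_apply, Finsupp.single_apply, Finsupp.single_apply, if_pos rfl,
    if_neg h, add_zero]

theorem entryExponent_succ (r a : ℕ) (i : Fin (r + 1)) :
    entryExponent r a i.succ = if min a (r + 1) = i + 1 then 1 else 0 := by
  rw [entryExponent, Finsupp.add_apply, Finsupp.single_apply, Finsupp.single_apply,
    if_neg (Fin.succ_ne_zero i).symm, zero_add]
  simp only [Fin.ext_iff, val_ofNat_min, Fin.val_succ]

theorem height_cons (i a : ℕ) (k : List ℕ) :
    height i (a :: k) = height i k + if i + 1 ≤ a then 1 else 0 := by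
  simp [height, List.countP_cons]

theorem sum_range_ite_le (r a : ℕ) :
    ∑ i ∈ Finset.range r, (if i + 1 + 1 ≤ a then 1 else 0) = min r (a - 1) := by
  induction r with
  | zero => simp
  | succ r ih =>
    rw [Finset.sum_range_succ, ih]
    split_ifs <;> omega

/-- An entry a contributes u_(a+1) if a ≤ r, and u_1^(a-r-1) u_(r+2) otherwise. Differences of
consecutive heights count the entries of a given size, the last height counting all entries above r.
-/
theorem exponent_eq_listExponent (r : ℕ) {k : List ℕ} (hk : ∀ a ∈ k, 0 < a) :
    exponent k.sum k.length (fun i : Fin r => height (i + 1) k) = listExponent r k := by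
  -- Entrywise this is a = 1 + min r (a - 1) + (a - (r + 1)).
  have h0 : k.sum = k.length + ∑ i ∈ Finset.range r, height (i + 1) k + listExponent r k 0 := by
    induction k with
    | nil => simp [listExponent, height]
    | cons a k ih =>
      have ih' := ih fun b hb => hk b (List.mem_cons_of_mem _ hb)
      have ha := hk a (by simp)
      rw [listExponent] at ih' ⊢
      rw [List.map_cons, List.sum_cons, List.sum_cons, Finsupp.add_apply, entryExponent_zero ha,
        List.length_cons]
      simp only [height_cons, Finset.sum_add_distrib, sum_range_ite_le]
      omega
  have h1 : ∀ i : Fin (r + 1),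
      height i k = (if (i : ℕ) < r then height (i + 1) k else 0) + listExponent r k i.succ := by
    intro i
    clear h0
    induction k with
    | nil => simp [listExponent, height]
    | cons a k ih =>
      have ih' := ih fun b hb => hk b (List.mem_cons_of_mem _ hb)
      have ha := hk a (by simp)
      have hi := i.isLt
      rw [listExponent] at ih' ⊢
      rw [List.map_cons, List.sum_cons, Finsupp.add_apply, entryExponent_succ, height_cons, ih',
        height_cons]
      split_ifs <;> omega
  have hlen : k.length = height 0 k := by
    rw [height, eq_comm, List.countP_eq_length]
    exact fun a ha => decide_eq_true (Nat.succ_le_of_lt (hk a ha))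
  have hseq : ∀ i : Fin (r + 1), heightSeq k.length (fun i : Fin r => height (i + 1) k) i =
      height i k := by
    rintro ⟨_ | i, hi⟩
    · exact hlen
    · simp only [heightSeq]
      rw [dif_pos (by omega)]
  ext i
  refine Fin.cases ?_ (fun i => ?_) i
  · simp only [exponent, Finsupp.equivFunOnFinite_symm_apply_apply, Fin.cons_zero]
    rw [Fin.sum_univ_eq_sum_range fun i => height (i + 1) k]
    omega
  · simp only [exponent, Finsupp.equivFunOnFinite_symm_apply_apply, Fin.cons_succ]
    rw [hseq, h1]
    simp only [heightSeq]
    split_ifs <;> omega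

/-- The multi-indices that contribute to the coefficient of `Psi` with exponents `e`. -/
def listsOf (r : ℕ) (e : Fin (r + 2) →₀ ℕ) : Finset (List ℕ) :=
  (Finset.univ.image fun c : Composition (weightOf r e) => c.blocks).filter
    fun k => listExponent r k = e

theorem mem_listsOf {r : ℕ} {e : Fin (r + 2) →₀ ℕ} {k : List ℕ} :
    k ∈ listsOf r e ↔ (∀ a ∈ k, 0 < a) ∧ listExponent r k = e := by
  simp only [listsOf, Finset.mem_filter, Finset.mem_image, Finset.mem_univ, true_and]
  constructor
  · rintro ⟨⟨c, rfl⟩, h⟩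
    exact ⟨fun a ha => c.blocks_pos ha, h⟩
  · rintro ⟨hk, rfl⟩
    exact ⟨⟨⟨k, fun {a} ha => hk a ha, (weightOf_listExponent hk).symm⟩, rfl⟩, rfl⟩

/-- The generating function of a function on multi-indices. -/
def listSeries (r : ℕ) (Z : List ℕ → ℂ[X]) : MvPowerSeries (Fin (r + 2)) ℂ[X] :=
  fun e => ∑ k ∈ listsOf r e, Z k

theorem coeff_listSeries (r : ℕ) (Z : List ℕ → ℂ[X]) (e : Fin (r + 2) →₀ ℕ) :
    MvPowerSeries.coeff e (listSeries r Z) = ∑ k ∈ listsOf r e, Z k := rfl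

/-- The sets of multi-indices with given weight, depth and heights are the fibres of `stat`, and the
monomial is constant on each of them. -/
theorem Psi_eq_listSeries (n : ℕ) (q : ℂ) (r : ℕ) :
    Psi n q r = listSeries r (zbarInterp n q) := by
  classical
  funext e
  change ∑ᶠ p : ℕ × ℕ × (Fin r → ℕ), _ = ∑ k ∈ listsOf r e, zbarInterp n q k
  let stat : List ℕ → ℕ × ℕ × (Fin r → ℕ) := fun k =>
    (k.sum, k.length, fun i => height (i + 1) k)
  have hstat : ∀ k ∈ listsOf r e, exponent (stat k).1 (stat k).2.1 (stat k).2.2 = e := by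
    intro k hk
    obtain ⟨h1, h2⟩ := mem_listsOf.mp hk
    rw [← h2]
    exact exponent_eq_listExponent r h1
  rw [finsum_eq_sum_of_support_subset (s := (listsOf r e).image stat)]
  · rw [← Finset.sum_fiberwise_of_maps_to (t := (listsOf r e).image stat) (g := stat)
      fun k hk => Finset.mem_image_of_mem _ hk]
    refine Finset.sum_congr rfl fun p hp => ?_
    obtain ⟨k, hk, rfl⟩ := Finset.mem_image.mp hp
    have he := hstat k hk
    rw [he, MvPowerSeries.coeff_monomial_same, G]
    refine Finset.sum_nbij (fun c => c.blocks) ?_ ?_ ?_ fun _ _ => rfl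
    · intro c hc
      simp only [indexSet, Finset.mem_filter, Finset.mem_univ, true_and] at hc
      obtain ⟨h1, h2⟩ := hc
      have hs : stat c.blocks = stat k := by
        refine Prod.ext c.blocks_sum (Prod.ext h1 (funext h2))
      rw [Finset.mem_filter, mem_listsOf]
      refine ⟨⟨fun a ha => c.blocks_pos ha, ?_⟩, hs⟩
      rw [← exponent_eq_listExponent r fun a ha => c.blocks_pos ha]
      exact (congrArg (fun p => exponent p.1 p.2.1 p.2.2) hs).trans he
    · intro c _ c' _ h
      exact Composition.ext h
    · intro k' hk'
      obtain ⟨h1, h2⟩ := Finset.mem_filter.mp (Finset.mem_coe.mp hk')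
      have h3 := (mem_listsOf.mp h1).1
      refine ⟨⟨k', fun {a} ha => h3 a ha, congrArg Prod.fst h2⟩, ?_, rfl⟩
      simp only [indexSet, Finset.coe_filter, Finset.mem_univ, true_and, Set.mem_ofPred_eq]
      exact ⟨congrArg (fun p => p.2.1) h2, fun i => congrFun (congrArg (fun p => p.2.2) h2) i⟩
  · rintro ⟨k, l, h⟩ hp
    simp only [Function.mem_support, MvPowerSeries.coeff_monomial, ne_eq, ite_eq_right_iff,
      Classical.not_imp] at hp
    obtain ⟨he, hG⟩ := hp
    obtain ⟨c, hc, -⟩ := Finset.exists_ne_zero_of_sum_ne_zero hG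
    simp only [indexSet, Finset.mem_filter, Finset.mem_univ, true_and] at hc
    obtain ⟨rfl, hh⟩ := hc
    have hs : stat c.blocks = (k, c.length, h) :=
      Prod.ext c.blocks_sum (Prod.ext rfl (funext hh))
    rw [Finset.mem_coe, ← hs]
    refine Finset.mem_image_of_mem _ (mem_listsOf.mpr ⟨fun a ha => c.blocks_pos ha, ?_⟩)
    rw [← exponent_eq_listExponent r fun a ha => c.blocks_pos ha, he]
    change exponent (stat c.blocks).1 (stat c.blocks).2.1 (stat c.blocks).2.2 = _
    rw [hs]

/-! ### Splitting off the first entry -/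

/-- The possible entries of a multi-index that contribute a given monomial. -/
def entriesOf (r : ℕ) (e : Fin (r + 2) →₀ ℕ) : Finset ℕ :=
  ({weightOf r e} : Finset ℕ).filter fun a => 0 < a ∧ entryExponent r a = e

theorem mem_entriesOf {r : ℕ} {e : Fin (r + 2) →₀ ℕ} {a : ℕ} :
    a ∈ entriesOf r e ↔ 0 < a ∧ entryExponent r a = e := by
  simp only [entriesOf, Finset.mem_filter, Finset.mem_singleton, and_iff_right_iff_imp]
  rintro ⟨h, rfl⟩
  exact (weightOf_entryExponent h).symm

/-- The generating function of a function on the entries of multi-indices. -/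
def entrySeries (r : ℕ) (f : ℕ → ℂ[X]) : MvPowerSeries (Fin (r + 2)) ℂ[X] :=
  fun e => ∑ a ∈ entriesOf r e, f a

theorem coeff_entrySeries (r : ℕ) (f : ℕ → ℂ[X]) (e : Fin (r + 2) →₀ ℕ) :
    MvPowerSeries.coeff e (entrySeries r f) = ∑ a ∈ entriesOf r e, f a := rfl

theorem listExponent_cons (r a : ℕ) (k : List ℕ) :
    listExponent r (a :: k) = entryExponent r a + listExponent r k := by
  simp [listExponent]

/-- Prefixing an entry is a bijection onto nonempty multi-indices and multiplies monomials. The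
empty multi-index is not reached, hence `hnil`. -/
theorem listSeries_eq_entrySeries_mul (r : ℕ) {f : ℕ → ℂ[X]} {Z Z' : List ℕ → ℂ[X]}
    (hnil : Z' [] = 0)
    (hcons : ∀ a k, 0 < a → (∀ b ∈ k, 0 < b) → Z' (a :: k) = f a * Z k) :
    listSeries r Z' = entrySeries r f * listSeries r Z := by
  classical
  ext1 e
  rw [MvPowerSeries.coeff_mul, coeff_listSeries]
  simp only [coeff_listSeries, coeff_entrySeries, Finset.sum_mul_sum, ← Finset.sum_product']
  rw [Finset.sum_sigma', eq_comm]
  refine Finset.sum_of_injOn (fun x => x.2.1 :: x.2.2) ?_ ?_ ?_ ?_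
  · rintro ⟨p, a, k⟩ hx ⟨p', a', k'⟩ hx' h
    simp only [Finset.coe_sigma, Set.mem_sigma_iff, Finset.mem_coe, Finset.mem_product,
      mem_entriesOf, mem_listsOf] at hx hx'
    obtain ⟨rfl, rfl⟩ := List.cons_eq_cons.mp h
    have : p = p' := Prod.ext (hx.2.1.2.symm.trans hx'.2.1.2) (hx.2.2.2.symm.trans hx'.2.2.2)
    rw [this]
  · rintro ⟨p, a, k⟩ hx
    simp only [Finset.coe_sigma, Set.mem_sigma_iff, Finset.mem_coe, Finset.mem_product,
      mem_entriesOf, mem_listsOf, Finset.HasAntidiagonal.mem_antidiagonal] at hx ⊢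
    obtain ⟨h1, ⟨h2, h3⟩, h4, h5⟩ := hx
    refine ⟨?_, by rw [listExponent_cons, h3, h5, h1]⟩
    intro b hb
    rcases List.mem_cons.mp hb with rfl | hb
    · exact h2
    · exact h4 b hb
  · intro k hk hk'
    obtain ⟨h1, h2⟩ := mem_listsOf.mp hk
    cases k with
    | nil => exact hnil
    | cons a k =>
      refine absurd ⟨⟨(entryExponent r a, listExponent r k), a, k⟩, ?_, rfl⟩ hk'
      simp only [Finset.coe_sigma, Set.mem_sigma_iff, Finset.mem_coe, Finset.mem_product,
        mem_entriesOf, mem_listsOf, Finset.HasAntidiagonal.mem_antidiagonal]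
      exact ⟨(listExponent_cons r a k).symm.trans h2, ⟨h1 a (by simp), trivial⟩,
        fun b hb => h1 b (List.mem_cons_of_mem _ hb), trivial⟩
  · rintro ⟨p, a, k⟩ hx
    simp only [Finset.mem_sigma, Finset.mem_product, mem_entriesOf, mem_listsOf] at hx
    exact (hcons a k hx.2.1.1 hx.2.2.1).symm

theorem Psi_one (q : ℂ) (r : ℕ) : Psi 1 q r = 1 := by
  classical
  rw [Psi_eq_listSeries]
  ext1 e
  rw [coeff_listSeries, MvPowerSeries.coeff_one]
  have h : ∀ k, k ≠ [] → zbarInterp 1 q k = 0 := fun k hk => by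
    cases k with
    | nil => exact absurd rfl hk
    | cons a k => exact zbarInterp_one_cons q a k
  split_ifs with he
  · rw [Finset.sum_eq_single [] (fun k _ hk => h k hk) fun hk => absurd ?_ hk, zbarInterp_nil]
    exact mem_listsOf.mpr ⟨by simp, by simp [listExponent, he]⟩
  · refine Finset.sum_eq_zero fun k hk => h k fun hk' => he ?_
    rw [← (mem_listsOf.mp hk).2, hk']
    simp [listExponent]

/-- The generating function of the factors for `m`. -/
def factorSeries (r : ℕ) (q : ℂ) (m : ℕ) : MvPowerSeries (Fin (r + 2)) ℂ[X] :=
  entrySeries r fun a => C (factor q m a)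

theorem Psi_succ {n : ℕ} (hn : 1 ≤ n) {q : ℂ} (hq : q ^ n ≠ 1) (r : ℕ) :
    Psi (n + 1) q r = Psi n q r + factorSeries r q n *
      (MvPowerSeries.C (1 - X) * Psi n q r + MvPowerSeries.C X * Psi (n + 1) q r) := by
  -- The difference of the two sums, unlike each of them, vanishes at the empty multi-index.
  have h := listSeries_eq_entrySeries_mul r (f := fun a => C (factor q n a))
    (Z := fun k => (1 - X) * zbarInterp n q k + X * zbarInterp (n + 1) q k)
    (Z' := fun k => zbarInterp (n + 1) q k - zbarInterp n q k) (by simp [zbarInterp_nil])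
    fun a k ha hk => by rw [zbarInterp_succ_cons hn hq ha hk]; ring
  have h1 : listSeries r (fun k => (1 - X) * zbarInterp n q k + X * zbarInterp (n + 1) q k) =
      MvPowerSeries.C (1 - X) * Psi n q r + MvPowerSeries.C X * Psi (n + 1) q r := by
    ext1 e
    simp only [Psi_eq_listSeries, map_add, MvPowerSeries.coeff_C_mul, coeff_listSeries,
      Finset.sum_add_distrib, Finset.mul_sum]
  have h2 : listSeries r (fun k => zbarInterp (n + 1) q k - zbarInterp n q k) =
      Psi (n + 1) q r - Psi n q r := by
    ext1 e
    simp [Psi_eq_listSeries, coeff_listSeries]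
  rw [h1, h2] at h
  rw [factorSeries, ← h]
  ring

/-! ### The series over entries: finite part and geometric tail -/

theorem entrySeries_eq_add_tail (r : ℕ) (f : ℕ → ℂ[X]) :
    entrySeries r f = ∑ a ∈ Finset.Icc 1 r, MvPowerSeries.monomial (entryExponent r a) (f a) +
      entrySeries r fun a => if r + 1 ≤ a then f a else 0 := by
  classical
  ext1 e
  simp only [map_add, map_sum, coeff_entrySeries, MvPowerSeries.coeff_monomial]
  rw [← Finset.sum_filter, ← Finset.sum_filter, ← Finset.sum_filter_not_add_sum_filter _
    (fun a => r + 1 ≤ a)]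
  congr 2
  ext a
  simp only [Finset.mem_filter, mem_entriesOf, Finset.mem_Icc, @eq_comm _ e]
  by_cases h : entryExponent r a = e
  · simp only [h, and_true]
    omega
  · simp [h]

theorem entryExponent_succ_of_le {r a : ℕ} (ha : r + 1 ≤ a) :
    entryExponent r (a + 1) = entryExponent r a + Finsupp.single 0 1 := by
  rw [entryExponent, entryExponent, min_eq_right ha, min_eq_right (by omega),
    show a + 1 - (r + 1) = a - (r + 1) + 1 by omega, Finsupp.single_add]
  abel

/-- An entry a ≥ r + 1 has u_1-exponent a - (r + 1): exponent 0 leaves only a = r + 1, and otherwise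
one factor u_1 can be removed by lowering a by one. -/
theorem tail_eq_add_shift (r : ℕ) (f : ℕ → ℂ[X]) :
    entrySeries r (fun a => if r + 1 ≤ a then f a else 0) =
      MvPowerSeries.monomial (entryExponent r (r + 1)) (f (r + 1)) +
        MvPowerSeries.X 0 * entrySeries r fun a => if r + 1 ≤ a then f (a + 1) else 0 := by
  classical
  ext1 e
  rw [map_add, coeff_entrySeries, MvPowerSeries.X, MvPowerSeries.coeff_monomial_mul,
    MvPowerSeries.coeff_monomial, coeff_entrySeries, one_mul]
  by_cases h0 : e 0 = 0
  · have hle : ¬ Finsupp.single 0 1 ≤ e := fun h => by simpa [h0] using h 0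
    rw [if_neg hle, add_zero]
    split_ifs with he
    · rw [Finset.sum_eq_single (r + 1)]
      · simp
      · intro a ha hne
        have := (mem_entriesOf.mp ha)
        rw [if_neg]
        intro har
        have h2 := entryExponent_zero (r := r) this.1
        rw [this.2, h0] at h2
        omega
      · intro ha
        exact absurd (mem_entriesOf.mpr ⟨Nat.succ_pos r, he.symm⟩) ha
    · refine Finset.sum_eq_zero fun a ha => if_neg fun har => he ?_
      have := (mem_entriesOf.mp ha)
      have h2 := entryExponent_zero (r := r) this.1
      rw [this.2, h0] at h2
      rw [← this.2, show a = r + 1 by omega]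
  · have hle : Finsupp.single 0 1 ≤ e := by
      simpa using Nat.one_le_iff_ne_zero.mpr h0
    obtain ⟨e, rfl⟩ := exists_add_of_le hle
    rw [if_pos hle, if_neg, zero_add, add_tsub_cancel_left, ← Finset.sum_filter,
      ← Finset.sum_filter]
    · refine Finset.sum_nbij' (fun a => a - 1) (fun a => a + 1) ?_ ?_ ?_ ?_ ?_
      · intro a ha
        simp only [Finset.mem_filter, mem_entriesOf] at ha ⊢
        obtain ⟨⟨h1, h2⟩, h3⟩ := ha
        have h4 := entryExponent_zero (r := r) h1
        rw [h2] at h4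
        have h5 : r + 1 ≤ a - 1 := by
          simp at h4
          omega
        refine ⟨⟨by omega, ?_⟩, h5⟩
        have h6 := entryExponent_succ_of_le h5
        rw [Nat.sub_add_cancel h1, h2, add_comm _ e] at h6
        exact (add_right_cancel h6).symm
      · intro a ha
        simp only [Finset.mem_filter, mem_entriesOf] at ha ⊢
        obtain ⟨⟨h1, h2⟩, h3⟩ := ha
        exact ⟨⟨by omega, by rw [entryExponent_succ_of_le h3, h2, add_comm e]⟩, by omega⟩
      · intro a ha
        have := (mem_entriesOf.mp (Finset.mem_filter.mp ha).1).1
        omega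
      · intro a _
        rfl
      · intro a ha
        have := (mem_entriesOf.mp (Finset.mem_filter.mp ha).1).1
        rw [Nat.sub_add_cancel this]
    · intro h
      have h4 := entryExponent_zero (r := r) (Nat.succ_pos r)
      rw [Nat.succ_eq_add_one, ← h] at h4
      simp at h4

/-- Complex numbers as constant elements of the fraction field. -/
def constHom (r : ℕ) : ℂ →+* Frac r :=
  ((algebraMap (MvPowerSeries (Fin (r + 2)) ℂ[X]) (Frac r)).comp MvPowerSeries.C).comp C

theorem const_C (r : ℕ) (z : ℂ) : const r (C z) = constHom r z := rfl

theorem factor_succ (q : ℂ) (m : ℕ) {a : ℕ} (ha : 0 < a) :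
    factor q m (a + 1) = q ^ m / (1 - q ^ m) * factor q m a := by
  obtain ⟨a, rfl⟩ := Nat.exists_eq_succ_of_ne_zero ha.ne'
  simp only [factor, Nat.succ_eq_add_one, Nat.add_sub_cancel]
  rw [div_mul_div_comm]
  congr 1 <;> ring

theorem factor_succ_eq (q : ℂ) (m a : ℕ) :
    factor q m (a + 1) = (1 - (1 - q ^ m)) ^ a / (1 - q ^ m) ^ (a + 1) := by
  rw [factor, Nat.add_sub_cancel, mul_comm, pow_mul, sub_sub_cancel]

theorem monomial_entryExponent {r a : ℕ} (ha : a ≤ r + 1) (c : ℂ[X]) :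
    MvPowerSeries.monomial (entryExponent r a) c =
      MvPowerSeries.C c * MvPowerSeries.X (Fin.ofNat (r + 2) a) := by
  rw [entryExponent, Nat.sub_eq_zero_of_le ha, min_eq_left ha, Finsupp.single_zero, zero_add,
    MvPowerSeries.X, ← MvPowerSeries.monomial_zero_eq_C_apply, MvPowerSeries.monomial_mul_monomial,
    zero_add, mul_one]

/-- Here τ is the part from entries a ≥ r + 1. Consecutive factors have ratio (1 - T) / T with T = 1
- q^m, so the shift relation becomes a linear equation for τ. -/
theorem algebraMap_factorSeries (r : ℕ) {q : ℂ} {m : ℕ} (hm : q ^ m ≠ 1) :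
    ∃ τ : Frac r, algebraMap _ (Frac r) (factorSeries r q m) =
        ∑ a ∈ Finset.range r,
          (1 - constHom r (1 - q ^ m)) ^ a / constHom r (1 - q ^ m) ^ (a + 1) * u r (a + 2) + τ ∧
      constHom r (1 - q ^ m) * τ =
        (1 - constHom r (1 - q ^ m)) ^ r / constHom r (1 - q ^ m) ^ r * u r (r + 2) +
          u r 1 * (1 - constHom r (1 - q ^ m)) * τ := by
  have hT : constHom r (1 - q ^ m) ≠ 0 := by
    rw [Ne, map_eq_zero]
    exact sub_ne_zero.mpr hm.symm
  have hmon : ∀ a, a ≤ r → algebraMap (MvPowerSeries (Fin (r + 2)) ℂ[X]) (Frac r)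
      (MvPowerSeries.monomial (entryExponent r (a + 1)) (C (factor q m (a + 1)))) =
      (1 - constHom r (1 - q ^ m)) ^ a / constHom r (1 - q ^ m) ^ (a + 1) * u r (a + 2) := by
    intro a ha
    rw [monomial_entryExponent (by omega), map_mul, factor_succ_eq]
    change constHom r _ * _ = _
    rw [map_div₀, map_pow, map_pow, map_sub _ 1, map_one]
    rfl
  let tail := entrySeries r fun a => if r + 1 ≤ a then C (factor q m a) else 0
  have htail : tail = MvPowerSeries.monomial (entryExponent r (r + 1)) (C (factor q m (r + 1))) +
      MvPowerSeries.X 0 * (MvPowerSeries.C (C (q ^ m / (1 - q ^ m))) * tail) := by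
    refine (tail_eq_add_shift r fun a => C (factor q m a)).trans ?_
    congr 2
    ext1 e
    rw [MvPowerSeries.coeff_C_mul, coeff_entrySeries, coeff_entrySeries, Finset.mul_sum]
    refine Finset.sum_congr rfl fun a ha => ?_
    rw [factor_succ q m (mem_entriesOf.mp ha).1, C_mul]
    split_ifs <;> simp
  refine ⟨algebraMap _ _ tail, ?_, ?_⟩
  · rw [factorSeries, entrySeries_eq_add_tail, map_add, map_sum]
    congr 1
    refine (Finset.sum_Ico_add' (fun a => algebraMap
      (MvPowerSeries (Fin (r + 2)) ℂ[X]) (Frac r)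
      (MvPowerSeries.monomial (entryExponent r a) (C (factor q m a)))) 0 r 1).symm.trans ?_
    rw [← Finset.range_eq_Ico]
    exact Finset.sum_congr rfl fun a ha => hmon a (Finset.mem_range.mp ha).le
  · have h := congrArg (algebraMap (MvPowerSeries (Fin (r + 2)) ℂ[X]) (Frac r)) htail
    rw [map_add, hmon r le_rfl, map_mul, map_mul] at h
    have hu : algebraMap (MvPowerSeries (Fin (r + 2)) ℂ[X]) (Frac r) (MvPowerSeries.X 0) = u r 1 :=
      rfl
    have hρ : algebraMap (MvPowerSeries (Fin (r + 2)) ℂ[X]) (Frac r)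
        (MvPowerSeries.C (C (q ^ m / (1 - q ^ m)))) =
        (1 - constHom r (1 - q ^ m)) / constHom r (1 - q ^ m) := by
      change constHom r _ = _
      rw [map_div₀, map_sub _ 1, map_one, sub_sub_cancel]
    rw [hu, hρ] at h
    generalize algebraMap (MvPowerSeries (Fin (r + 2)) ℂ[X]) (Frac r) tail = τ at h ⊢
    generalize constHom r (1 - q ^ m) = T at *
    nth_rewrite 1 [h]
    field_simp
    ring

/-! ### Factorization of P^s(T) -/

theorem u_one_ne_zero (r : ℕ) : u r 1 ≠ 0 := by
  rw [u, Ne, FaithfulSMul.algebraMap_eq_zero_iff]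
  intro h
  have := congrArg (MvPowerSeries.coeff (Finsupp.single (Fin.ofNat (r + 2) 0) 1)) h
  rw [MvPowerSeries.coeff_index_single_self_X] at this
  simp at this

theorem algebraMap_ne_zero_of_constantCoeff {r : ℕ} {f : MvPowerSeries (Fin (r + 2)) ℂ[X]}
    (hf : MvPowerSeries.constantCoeff f ≠ 0) : algebraMap _ (Frac r) f ≠ 0 := by
  rw [Ne, FaithfulSMul.algebraMap_eq_zero_iff]
  rintro rfl
  simp at hf

theorem one_add_u_one_ne_zero (r : ℕ) : 1 + u r 1 ≠ 0 := by
  have h := algebraMap_ne_zero_of_constantCoeff (r := r)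
    (f := 1 + MvPowerSeries.X (Fin.ofNat (r + 2) 0)) (by simp)
  rwa [map_add, map_one] at h

theorem x_one (r : ℕ) : x r 1 = u r 1 / (1 + u r 1) := if_pos rfl

/-- The binomials vanish for j < k, so the summation range can be made independent of k; this
permits exchanging sums later. -/
theorem x_add_two (r k : ℕ) :
    x r (k + 2) = ∑ j ∈ Finset.range r, (-1) ^ (j - k) * (j.choose k : Frac r) *
        (u r (j + 2) - u r (r + 2) / u r 1 ^ (r - j)) +
      u r (r + 2) / (u r 1 ^ (r - k) * (1 + u r 1) ^ (k + 1)) := by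
  rw [x, if_neg (by omega)]
  congr 1
  · have h : Finset.Icc (k + 2) (r + 1) = Finset.Ico (k + 2) (r + 2) := rfl
    rw [h, ← Finset.sum_Ico_add']
    simp only [Nat.add_sub_add_right, Nat.add_sub_cancel]
    rw [Finset.range_eq_Ico]
    refine Finset.sum_subset (Finset.Ico_subset_Ico_left (Nat.zero_le k)) fun j hj hj' => ?_
    have : j < k := by
      simp only [Finset.mem_Ico] at hj hj'
      omega
    rw [Nat.choose_eq_zero_of_lt this]
    simp
  · simp

theorem x_top (r : ℕ) : x r (r + 2) = u r (r + 2) / (1 + u r 1) ^ (r + 1) := by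
  rw [x_add_two, Finset.sum_eq_zero fun j hj => ?_]
  · simp
  · rw [Nat.choose_eq_zero_of_lt (Finset.mem_range.mp hj)]
    simp

/-- The binomial expansion of (1 - T)^j; it explains the signed binomials in the x_i. -/
theorem sum_choose_mul_pow {K : Type*} [Field K] {r j : ℕ} (hj : j < r) (T : K) :
    ∑ k ∈ Finset.range r, (-1) ^ (j - k) * (j.choose k : K) * T ^ (r - 1 - k) =
      T ^ (r - 1 - j) * (1 - T) ^ j := by
  rw [sub_eq_add_neg, add_pow, Finset.mul_sum]
  symm
  refine (Finset.sum_congr rfl fun k hk => ?_).trans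
    (Finset.sum_subset (Finset.range_subset_range.mpr hj) fun k _ hk => ?_)
  · have hk' : k ≤ j := Nat.lt_succ_iff.mp (Finset.mem_range.mp hk)
    rw [neg_pow, show r - 1 - k = (r - 1 - j) + (j - k) by omega, pow_add]
    ring
  · have hk' : j < k := by
      simpa using hk
    rw [Nat.choose_eq_zero_of_lt hk']
    simp

/-- The quotient of `x_2 T^r + ∑_{i=0}^{r-1} (x_(r+2-i) - x_1 x_(r+1-i)) T^i` by `T - x_1`. -/
theorem sum_x_mul_pow (r : ℕ) (T : Frac r) :
    ∑ i ∈ Finset.range r, x r (r + 1 - i) * T ^ i =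
      ∑ j ∈ Finset.range r, (u r (j + 2) - u r (r + 2) / u r 1 ^ (r - j)) *
          (T ^ (r - 1 - j) * (1 - T) ^ j) +
        ∑ j ∈ Finset.range r,
          u r (r + 2) / (u r 1 ^ (r - j) * (1 + u r 1) ^ (j + 1)) * T ^ (r - 1 - j) := by
  have h : ∑ i ∈ Finset.range r, x r (r + 1 - i) * T ^ i =
      ∑ k ∈ Finset.range r, x r (k + 2) * T ^ (r - 1 - k) := by
    rw [← Finset.sum_range_reflect]
    refine Finset.sum_congr rfl fun k hk => ?_
    have := Finset.mem_range.mp hk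
    rw [show r + 1 - (r - 1 - k) = k + 2 by omega]
  rw [h]
  simp only [x_add_two, add_mul, Finset.sum_add_distrib, Finset.sum_mul]
  rw [Finset.sum_comm]
  congr 1
  refine Finset.sum_congr rfl fun j hj => ?_
  rw [← sum_choose_mul_pow (Finset.mem_range.mp hj), Finset.mul_sum]
  exact Finset.sum_congr rfl fun k _ => by ring

/-- Both sums are of the form Σ a^j b^(r-1-j) with b = T / v, and in each a - b is a multiple of T -
v / (1 + v). After telescoping, the two copies of b^r cancel. -/
theorem geometric_identity {K : Type*} [Field K] {v : K} (hv : v ≠ 0) (hv' : 1 + v ≠ 0)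
    (w T : K) (r : ℕ) :
    (T - v / (1 + v)) * (∑ j ∈ Finset.range r, w / (v ^ (r - j) * (1 + v) ^ (j + 1)) *
        T ^ (r - 1 - j) - ∑ j ∈ Finset.range r, w / v ^ (r - j) * (T ^ (r - 1 - j) * (1 - T) ^ j)) +
      w / (1 + v) ^ (r + 1) = w * (1 - T) ^ r / (1 + v) := by
  have h1 : ∑ j ∈ Finset.range r, w / v ^ (r - j) * (T ^ (r - 1 - j) * (1 - T) ^ j) =
      w / v * ∑ j ∈ Finset.range r, (1 - T) ^ j * (T / v) ^ (r - 1 - j) := by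
    rw [Finset.mul_sum]
    refine Finset.sum_congr rfl fun j hj => ?_
    have := Finset.mem_range.mp hj
    rw [show r - j = r - 1 - j + 1 by omega, div_pow]
    field_simp
    ring
  have h2 : ∑ j ∈ Finset.range r, w / (v ^ (r - j) * (1 + v) ^ (j + 1)) * T ^ (r - 1 - j) =
      w / v / (1 + v) * ∑ j ∈ Finset.range r, (1 / (1 + v)) ^ j * (T / v) ^ (r - 1 - j) := by
    rw [Finset.mul_sum]
    refine Finset.sum_congr rfl fun j hj => ?_
    have := Finset.mem_range.mp hj
    rw [show r - j = r - 1 - j + 1 by omega, div_pow, div_pow]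
    field_simp
    ring
  have g1 := (Commute.all (1 - T) (T / v)).geom_sum₂_mul r
  have g2 := (Commute.all (1 / (1 + v)) (T / v)).geom_sum₂_mul r
  have e1 : 1 - T - T / v = -((1 + v) / v) * (T - v / (1 + v)) := by
    field_simp
    ring
  have e2 : 1 / (1 + v) - T / v = -(1 / v) * (T - v / (1 + v)) := by
    field_simp
    ring
  have e3 : w / (1 + v) ^ (r + 1) = w * (1 / (1 + v)) ^ r / (1 + v) := by
    rw [div_pow]
    field_simp
    ring
  rw [e1] at g1
  rw [e2] at g2
  rw [h1, h2, e3]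
  generalize ∑ j ∈ Finset.range r, (1 - T) ^ j * (T / v) ^ (r - 1 - j) = S1 at *
  generalize ∑ j ∈ Finset.range r, (1 / (1 + v)) ^ j * (T / v) ^ (r - 1 - j) = S2 at *
  have e4 : (1 + v) / v * (1 / (1 + v)) = 1 / v := by field_simp
  linear_combination (w / (1 + v)) * g1 - (w / (1 + v)) * g2
    + w * S1 * (T - v / (1 + v)) * e4

/-- Dividing the coefficient of -s in P^s(T) by T - x_1 leaves remainder x_(r+2). The finite part of
φ matches the u_j terms of the quotient; the tail τ matches its u_(r+2) terms together with the
remainder, by `geometric_identity`. -/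
theorem P_eq {r : ℕ} {T φ τ : Frac r} (hT : T ≠ 0)
    (hφ : φ = ∑ a ∈ Finset.range r, (1 - T) ^ a / T ^ (a + 1) * u r (a + 2) + τ)
    (hτ : T * τ = (1 - T) ^ r / T ^ r * u r (r + 2) + u r 1 * (1 - T) * τ) (s : Frac r) :
    P r s T = T ^ r * (T - x r 1) * (1 - s * φ) := by
  have hsum : x r 2 * T ^ r +
      ∑ i ∈ Finset.range r, (x r (r + 2 - i) - x r 1 * x r (r + 1 - i)) * T ^ i =
      (T - x r 1) * ∑ i ∈ Finset.range r, x r (r + 1 - i) * T ^ i + x r (r + 2) := by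
    have h1 := Finset.sum_range_succ (fun i => x r (r + 2 - i) * T ^ i) r
    rw [Finset.sum_range_succ'] at h1
    simp only [Nat.add_sub_cancel_left, pow_zero, mul_one, Nat.sub_zero,
      show ∀ i, r + 2 - (i + 1) = r + 1 - i by omega] at h1
    have h2 : ∑ i ∈ Finset.range r, x r (r + 1 - i) * T ^ (i + 1) =
        T * ∑ i ∈ Finset.range r, x r (r + 1 - i) * T ^ i := by
      rw [Finset.mul_sum]
      exact Finset.sum_congr rfl fun i _ => by ring
    have h3 : ∑ i ∈ Finset.range r, (x r (r + 2 - i) - x r 1 * x r (r + 1 - i)) * T ^ i =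
        ∑ i ∈ Finset.range r, x r (r + 2 - i) * T ^ i -
          x r 1 * ∑ i ∈ Finset.range r, x r (r + 1 - i) * T ^ i := by
      rw [Finset.mul_sum, ← Finset.sum_sub_distrib]
      exact Finset.sum_congr rfl fun i _ => by ring
    rw [h3]
    rw [h2] at h1
    linear_combination -h1
  have hv := u_one_ne_zero r
  have hv' := one_add_u_one_ne_zero r
  have hgeom := geometric_identity hv hv' (u r (r + 2)) T r
  -- (1 + u_1)(T - x_1) = T - u_1 (1 - T), exactly the denominator of the geometric series τ.
  have hτ' : T ^ r * (T - x r 1) * τ = u r (r + 2) * (1 - T) ^ r / (1 + u r 1) := by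
    rw [x_one]
    have hTr : T ^ r ≠ 0 := pow_ne_zero r hT
    have : T ^ r * (T * τ) = (1 - T) ^ r * u r (r + 2) + T ^ r * (u r 1 * (1 - T) * τ) := by
      rw [hτ]
      field_simp
    field_simp
    linear_combination this
  have hpoly : T ^ r * ∑ a ∈ Finset.range r, (1 - T) ^ a / T ^ (a + 1) * u r (a + 2) =
      ∑ j ∈ Finset.range r, u r (j + 2) * (T ^ (r - 1 - j) * (1 - T) ^ j) := by
    rw [Finset.mul_sum]
    refine Finset.sum_congr rfl fun j hj => ?_
    have := Finset.mem_range.mp hj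
    have hr : T ^ r = T ^ (r - 1 - j) * T ^ (j + 1) := by
      rw [← pow_add]
      congr 1
      omega
    rw [hr]
    field_simp
  have hkey : T ^ r * (T - x r 1) * φ =
      (T - x r 1) * ∑ i ∈ Finset.range r, x r (r + 1 - i) * T ^ i + x r (r + 2) := by
    rw [sum_x_mul_pow, x_top, hφ]
    simp only [sub_mul _ _ (T ^ _ * _), Finset.sum_sub_distrib]
    rw [x_one] at hτ' ⊢
    linear_combination hτ' + (T - u r 1 / (1 + u r 1)) * hpoly - hgeom
  rw [P]
  linear_combination s * hkey - s * hsum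

/-! ### Non-vanishing and the product formula -/

theorem constantCoeff_factorSeries (r : ℕ) (q : ℂ) (m : ℕ) :
    MvPowerSeries.constantCoeff (factorSeries r q m) = 0 := by
  rw [← MvPowerSeries.coeff_zero_eq_constantCoeff_apply, factorSeries, coeff_entrySeries]
  refine Finset.sum_eq_zero fun a ha => ?_
  obtain ⟨h1, h2⟩ := mem_entriesOf.mp ha
  have := weightOf_entryExponent (r := r) h1
  rw [h2, map_zero] at this
  omega

/-- Multiplying by 1 + u_1 gives a power series with constant coefficient z. -/
theorem constHom_sub_x_one_ne_zero (r : ℕ) {z : ℂ} (hz : z ≠ 0) : constHom r z - x r 1 ≠ 0 := by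
  have h := algebraMap_ne_zero_of_constantCoeff (r := r)
    (f := MvPowerSeries.C (C z) * (1 + MvPowerSeries.X (Fin.ofNat (r + 2) 0)) -
      MvPowerSeries.X (Fin.ofNat (r + 2) 0)) (by simpa using hz)
  rw [map_sub, map_mul, map_add, map_one] at h
  change constHom r z * (1 + u r 1) - u r 1 ≠ 0 at h
  rw [x_one]
  have hv' := one_add_u_one_ne_zero r
  contrapose! h
  field_simp at h
  linear_combination h

theorem P_const {r : ℕ} {q : ℂ} {m : ℕ} (hm : q ^ m ≠ 1) (s : ℂ[X]) :
    P r (const r s) (const r (C (1 - q ^ m))) =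
      constHom r (1 - q ^ m) ^ r * (constHom r (1 - q ^ m) - x r 1) *
        algebraMap _ (Frac r) (1 - MvPowerSeries.C s * factorSeries r q m) := by
  obtain ⟨τ, hφ, hτ⟩ := algebraMap_factorSeries r hm
  have hT : constHom r (1 - q ^ m) ≠ 0 := by
    rw [Ne, map_eq_zero]
    exact sub_ne_zero.mpr hm.symm
  rw [const_C, P_eq hT hφ hτ, map_sub (algebraMap _ _), map_one, map_mul]
  rfl

theorem P_const_ne_zero {r : ℕ} {q : ℂ} {m : ℕ} (hm : q ^ m ≠ 1) (s : ℂ[X]) :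
    P r (const r s) (const r (C (1 - q ^ m))) ≠ 0 := by
  have hz : 1 - q ^ m ≠ 0 := sub_ne_zero.mpr hm.symm
  rw [P_const hm]
  refine mul_ne_zero (mul_ne_zero (pow_ne_zero r ?_) (constHom_sub_x_one_ne_zero r hz))
    (algebraMap_ne_zero_of_constantCoeff ?_)
  · rwa [Ne, map_eq_zero]
  · simp [constantCoeff_factorSeries]

/-- Both values of P share the prefactor T^r (T - x_1), so this is a multiple of the rearranged
`Psi_succ`. -/
theorem algebraMap_Psi_succ_mul_P {n : ℕ} (hn : 1 ≤ n) {q : ℂ} (hq : q ^ n ≠ 1) (r : ℕ) :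
    algebraMap _ (Frac r) (Psi (n + 1) q r) * P r (const r X) (const r (C (1 - q ^ n))) =
      algebraMap _ (Frac r) (Psi n q r) * P r (const r (X - 1)) (const r (C (1 - q ^ n))) := by
  have h : Psi (n + 1) q r * (1 - MvPowerSeries.C X * factorSeries r q n) =
      Psi n q r * (1 - MvPowerSeries.C (X - 1) * factorSeries r q n) := by
    have h1 := Psi_succ hn hq r
    rw [map_sub, map_one] at h1 ⊢
    linear_combination h1
  have h2 := congrArg (algebraMap _ (Frac r)) h
  rw [map_mul, map_mul] at h2
  rw [P_const hq, P_const hq]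
  linear_combination constHom r (1 - q ^ n) ^ r * (constHom r (1 - q ^ n) - x r 1) * h2

theorem algebraMap_Psi_mul_prod_P (r : ℕ) {n : ℕ} (hn : 1 ≤ n) {q : ℂ}
    (hq : ∀ m : ℕ, 0 < m → m < n → q ^ m ≠ 1) :
    algebraMap _ (Frac r) (Psi n q r) *
        ∏ j ∈ Finset.Ico 1 n, P r (const r X) (const r (C (1 - q ^ j))) =
      ∏ j ∈ Finset.Ico 1 n, P r (const r (X - 1)) (const r (C (1 - q ^ j))) := by
  induction n, hn using Nat.le_induction with
  | base => simp [Psi_one]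
  | succ n hn ih =>
    rw [Finset.prod_Ico_succ_top hn, Finset.prod_Ico_succ_top hn,
      ← ih fun m h0 hm => hq m h0 (hm.trans (Nat.lt_succ_self n))]
    linear_combination (∏ j ∈ Finset.Ico 1 n, P r (const r X) (const r (C (1 - q ^ j)))) *
      algebraMap_Psi_succ_mul_P hn (hq n hn (Nat.lt_succ_self n)) r

end QHarmonic

end

theorem theorem1p1 (r : ℕ) (hr : 1 ≤ r) (n : ℕ) (hn : 1 ≤ n) (q : ℂ)
    (hq : ∀ m : ℕ, 0 < m → m < n → q ^ m ≠ 1) :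
    (∏ j ∈ Finset.Ico 1 n, QHarmonic.P r (QHarmonic.const r Polynomial.X)
        (QHarmonic.const r (Polynomial.C (1 - q ^ j)))) ≠ 0 ∧
    algebraMap (MvPowerSeries (Fin (r + 2)) (Polynomial ℂ)) (QHarmonic.Frac r)
        (QHarmonic.Psi n q r) =
      (∏ j ∈ Finset.Ico 1 n, QHarmonic.P r (QHarmonic.const r (Polynomial.X - 1))
          (QHarmonic.const r (Polynomial.C (1 - q ^ j)))) /
        (∏ j ∈ Finset.Ico 1 n, QHarmonic.P r (QHarmonic.const r Polynomial.X)
          (QHarmonic.const r (Polynomial.C (1 - q ^ j)))) := by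
  have hne : (∏ j ∈ Finset.Ico 1 n, QHarmonic.P r (QHarmonic.const r Polynomial.X)
      (QHarmonic.const r (Polynomial.C (1 - q ^ j)))) ≠ 0 :=
    Finset.prod_ne_zero_iff.mpr fun j hj =>
      QHarmonic.P_const_ne_zero (hq j (Finset.mem_Ico.mp hj).1 (Finset.mem_Ico.mp hj).2) _
  exact ⟨hne, (eq_div_iff hne).mpr (QHarmonic.algebraMap_Psi_mul_prod_P r hn hq)⟩
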